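/- **Minimax lower bound for supervised Gaussian mixture classification with unknown covariance.** Let $p,n\ge 1$. For a symmetric matrix $A\in\mathbb R^{p\times p}$ let $\|A\|_\infty$ denote its largest eigenvalue, and for a positive semidefinite $A\ne 0$ let $r(A)=\operatorname{Tr}(A)/\|A\|_\infty$ be its effective rank. For a positive definite matrix $\Sigma\in\mathbb R^{p\times p}$ and $\theta\in\mathbb R^p$ one observes the training sample $(\mathbf Y,\eta)=(Y_i,\eta_i)_{i\le n}$ with $$Y_i=\eta_i\theta+W_i,\qquad i=1,\dots,n,$$ where $W_1,\dots,W_n$ are i.i.d. $\mathcal N(0,\Sigma)$ and the label vector $\eta=(\eta_1,\dots,\eta_n)\in\{-1,1\}^n$ is independent of the noise and has an arbitrary law $\nu$ on $\{-1,1\}^n$ (for instance $\eta$ is deterministic, or its entries are i.i.d. Rademacher). The new observation, independent of the training sample, is $Y_{n+1}=\eta_{n+1}\theta+W_{n+1}$, where $\eta_{n+1}$ is Rademacher and independent of $W_{n+1}\sim\mathcal N(0,\Sigma)$. A classifier is a measurable map $\hat\eta:(\mathbb R^p\times\{-1,1\})^n\times\mathbb R^p\to\{-1,1\}$, and its generalization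 error is $$\mathcal R_\Sigma(\hat\eta)=\mathbb P\big(\hat\eta((\mathbf Y,\eta);Y_{n+1})\ne\eta_{n+1}\,\big|\,(\mathbf Y,\eta)\big).$$ There are absolute constants $c,C>0$ such that for all $p,n\ge 1$, all $\Delta,\lambda,r>0$ for which at least one positive definite $\Sigma\in\mathbb R^{p\times p}$ satisfies $\|\Sigma\|_\infty=\lambda$ and $r(\Sigma^2)=r$, and every law $\nu$ of the training labels, $$\inf_{\hat\eta}\ \sup_{\substack{\Sigma\ \text{positive definite}\\ r(\Sigma^2)=r,\ \|\Sigma\|_\infty=\lambda}}\ \sup_{\|\theta\|^2\ge\Delta^2\lambda}\mathbf E\big(\mathcal R_\Sigma(\hat\eta)\big)\ \ge\ C\exp\left(-c\,\frac{\Delta^4}{\Delta^2+\frac rn}\right),$$ where the infimum is over all classifiers and $\|\theta\|$ is the Euclidean norm. -/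

import Mathlib

open MeasureTheory ProbabilityTheory

noncomputable section

namespace GaussianMixture

/-- The feature space `ℝ^p` with its Euclidean norm. -/
abbrev Feature (p : ℕ) : Type := EuclideanSpace ℝ (Fin p)

/-- The labels `{-1, 1}`, as the units of `ℤ`. -/
abbrev Label : Type := ℤˣ

instance : MeasurableSingletonClass Label :=
  ⟨fun a => ⟨{(a : ℤ)}, measurableSet_singleton _, by ext b; simp [Units.ext_iff]⟩⟩

/-- A training sample `(Y_i, η_i)`, `i = 1, …, n`. -/
abbrev Sample (p n : ℕ) : Type := Fin n → Feature p × Label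

/-- The real number `±1` given by a label. -/
def Label.toReal (e : Label) : ℝ := ((e : ℤ) : ℝ)

/-- `‖A‖_∞`: the largest eigenvalue of a symmetric matrix `A`. -/
def specNorm {p : ℕ} (A : Matrix (Fin p) (Fin p) ℝ) : ℝ := sSup (spectrum ℝ A)

/-- The effective rank `r(A) = Tr A / ‖A‖_∞`. -/
def effRank {p : ℕ} (A : Matrix (Fin p) (Fin p) ℝ) : ℝ := A.trace / specNorm A

/-- The full-rank covariance matrices `S` on `ℝ^p` with `‖S‖_∞ = lam` and `r(S²) = r`. -/
def covClass (p : ℕ) (lam r : ℝ) : Set (Matrix (Fin p) (Fin p) ℝ) :=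
  {S | S.PosDef ∧ specNorm S = lam ∧ effRank (S ^ 2) = r}

/-- The signals `θ` with `‖θ‖² ≥ Δ² lam`. -/
def signalClass (p : ℕ) (Δ lam : ℝ) : Set (Feature p) :=
  {θ | Δ ^ 2 * lam ≤ ‖θ‖ ^ 2}

/-- The labelled sample with `Y_i = η_i θ + W_i`. -/
def mixSample {p n : ℕ} (θ : Feature p) (x : (Fin n → Label) × (Fin n → Feature p)) :
    Sample p n :=
  fun i => (Label.toReal (x.1 i) • θ + x.2 i, x.1 i)

/-- The law of the training sample: the label vector has law `ν`, the noise vectors `W_i` are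
i.i.d. `N(0, S)` and independent of the labels. -/
def trainLaw {p n : ℕ} (ν : Measure (Fin n → Label)) (S : Matrix (Fin p) (Fin p) ℝ)
    (θ : Feature p) : Measure (Sample p n) :=
  (ν.prod (Measure.pi fun _ : Fin n => multivariateGaussian (0 : Feature p) S)).map (mixSample θ)

/-- The Rademacher law: mass `1/2` on each of `1` and `-1`. -/
def rademacher : Measure Label :=
  (2⁻¹ : ENNReal) • Measure.dirac 1 + (2⁻¹ : ENNReal) • Measure.dirac (-1)

/-- The labelled observation with `Y = e θ + W`. -/
def mixPoint {p : ℕ} (θ : Feature p) (x : Label × Feature p) : Feature p × Label :=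
  (Label.toReal x.1 • θ + x.2, x.1)

/-- The law of the new observation `(Y_{n+1}, η_{n+1})`, with a Rademacher label and independent
noise `N(0, S)`. -/
def testLaw {p : ℕ} (S : Matrix (Fin p) (Fin p) ℝ) (θ : Feature p) :
    Measure (Feature p × Label) :=
  (rademacher.prod (multivariateGaussian (0 : Feature p) S)).map (mixPoint θ)

/-- The measurable classifiers: they map the training sample and a new feature vector to a
label. -/
def Classifier (p n : ℕ) : Type := {f : Sample p n × Feature p → Label // Measurable f}

/-- The generalization error given the training sample `D`. The new observation is independent
of the sample, so that the conditional probability of an error is its probability at fixed `D`. -/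
def condRisk {p n : ℕ} (f : Classifier p n) (S : Matrix (Fin p) (Fin p) ℝ) (θ : Feature p)
    (D : Sample p n) : ENNReal :=
  testLaw S θ {z | f.1 (D, z.1) ≠ z.2}

/-- The expectation of the generalization error over the training sample. -/
def expRisk {p n : ℕ} (ν : Measure (Fin n → Label)) (f : Classifier p n)
    (S : Matrix (Fin p) (Fin p) ℝ) (θ : Feature p) : ENNReal :=
  ∫⁻ D, condRisk f S θ D ∂(trainLaw ν S θ)

/-- The minimax risk: infimum over all measurable classifiers of the supremum over all `S` with
`‖S‖_∞ = lam`, `r(S²) = r` and over all `θ` with `‖θ‖² ≥ Δ² lam`. -/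
def minimaxRisk (p n : ℕ) (ν : Measure (Fin n → Label)) (Δ lam r : ℝ) : ENNReal :=
  ⨅ f : Classifier p n, ⨆ S ∈ covClass p lam r, ⨆ θ ∈ signalClass p Δ lam, expRisk ν f S θ

theorem measurable_mixSample {p n : ℕ} (θ : Feature p) :
    Measurable (mixSample (n := n) θ) := by
  have h : Measurable Label.toReal := measurable_of_finite _
  unfold mixSample
  fun_prop

theorem measurable_mixPoint {p : ℕ} (θ : Feature p) : Measurable (mixPoint θ) := by
  have h : Measurable Label.toReal := measurable_of_finite _
  unfold mixPoint
  fun_prop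

instance : IsProbabilityMeasure rademacher := by
  constructor
  simp [rademacher, ENNReal.inv_two_add_inv_two]

instance {p n : ℕ} (ν : Measure (Fin n → Label)) [IsProbabilityMeasure ν]
    (S : Matrix (Fin p) (Fin p) ℝ) (θ : Feature p) : IsProbabilityMeasure (trainLaw ν S θ) :=
  Measure.isProbabilityMeasure_map (measurable_mixSample θ).aemeasurable

instance {p : ℕ} (S : Matrix (Fin p) (Fin p) ℝ) (θ : Feature p) :
    IsProbabilityMeasure (testLaw S θ) :=
  Measure.isProbabilityMeasure_map (measurable_mixPoint θ).aemeasurable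

end GaussianMixture

end

namespace GaussianMixture

/-! ### Testing two densities -/

/-! The supremum over signals is bounded below by an average over random ones. Fix a diagonal
covariance of the class whose top eigenvalue `lam` has multiplicity k with r ≤ 2k
(`exists_diagonal_mem_covClass`). On these k coordinates let the signal be ±a√lam with independent
fair signs and a² = Δ²/k, so that ‖θ‖² = Δ² lam; elsewhere it vanishes.

Given the training labels η, the averaged problem is a test between the two values e = ±1 of the new
label. After rescaling, the observation is a product over coordinates of even mixtures of N(± a(η,
e), 1) on ℝⁿ × ℝ. The average error is at least a quarter of the squared Hellinger affinity, which
factors over coordinates. The bound is uniform in η, so ν plays no role.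

In one coordinate write X for the training form and Y = a y for the new observation. The densities
are proportional to cosh(X ± Y), and cosh(X + Y) cosh(X - Y) = cosh² X + cosh² Y - 1. Bounding the
root of this below by cosh X gives affinity at least exp(-a²/2), the affinity when the signs are
known. Bounding it by `mul_sub_le_sqrt` gives at least 1 - n a⁴, the effect of having to learn the
signs. The products over k coordinates are of order exp(-Δ²/2) and, if n a² ≤ 1/2, exp(-2nΔ⁴/k);
`exists_rate` picks the one that yields the claimed rate. -/

/-- Cauchy–Schwarz bound for the sum of the two error probabilities of a test by the Hellinger
affinity of the two densities. -/
theorem sq_lintegral_sqrt_mul_le {α : Type*} [MeasurableSpace α] {μ : Measure α}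
    {f g : α → ENNReal} (hf : Measurable f) (hg : Measurable g) (hf1 : ∫⁻ x, f x ∂μ ≤ 1)
    (hg1 : ∫⁻ x, g x ∂μ ≤ 1) {A : Set α} (hA : MeasurableSet A) :
    (∫⁻ x, f x ^ (1 / 2 : ℝ) * g x ^ (1 / 2 : ℝ) ∂μ) ^ 2 ≤
      2 * (μ.withDensity f A + μ.withDensity g Aᶜ) := by
  have key : ∀ ν : Measure α, ∫⁻ x, f x ^ (1 / 2 : ℝ) * g x ^ (1 / 2 : ℝ) ∂ν ≤
      (∫⁻ x, f x ∂ν) ^ (1 / 2 : ℝ) * (∫⁻ x, g x ∂ν) ^ (1 / 2 : ℝ) := fun ν =>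
    ENNReal.lintegral_mul_norm_pow_le hf.aemeasurable hg.aemeasurable (by norm_num)
      (by norm_num) (by norm_num)
  have sq : ∀ x : ENNReal, (x ^ (1 / 2 : ℝ)) ^ 2 = x := fun x => by
    rw [← ENNReal.rpow_natCast, ← ENNReal.rpow_mul]; simp
  have le1 : ∀ x : ENNReal, x ≤ 1 → x ^ (1 / 2 : ℝ) ≤ 1 := fun x hx =>
    ENNReal.rpow_le_one hx (by norm_num)
  rw [← lintegral_add_compl _ hA, withDensity_apply _ hA, withDensity_apply _ hA.compl]
  set x := ∫⁻ x in A, f x ∂μ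
  set y := ∫⁻ x in Aᶜ, g x ∂μ
  -- Cauchy–Schwarz on each piece, keeping only the factor that is an error probability and bounding
  -- the other by 1.
  have h1 : ∫⁻ x in A, f x ^ (1 / 2 : ℝ) * g x ^ (1 / 2 : ℝ) ∂μ ≤ x ^ (1 / 2 : ℝ) := by
    refine (key _).trans ?_
    exact mul_le_of_le_one_right' (le1 _ ((setLIntegral_le_lintegral _ _).trans hg1))
  have h2 : ∫⁻ x in Aᶜ, f x ^ (1 / 2 : ℝ) * g x ^ (1 / 2 : ℝ) ∂μ ≤ y ^ (1 / 2 : ℝ) := by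
    refine (key _).trans ?_
    exact mul_le_of_le_one_left' (le1 _ ((setLIntegral_le_lintegral _ _).trans hf1))
  calc _ ≤ (x ^ (1 / 2 : ℝ) + y ^ (1 / 2 : ℝ)) ^ 2 := by gcongr
    _ ≤ 2 ^ (2 - 1) * ((x ^ (1 / 2 : ℝ)) ^ 2 + (y ^ (1 / 2 : ℝ)) ^ 2) := by
      have := ENNReal.rpow_add_le_mul_rpow_add_rpow (x ^ (1 / 2 : ℝ)) (y ^ (1 / 2 : ℝ))
        (p := 2) (by norm_num)
      norm_num at this ⊢
      exact_mod_cast this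
    _ = 2 * (x + y) := by rw [sq, sq]; norm_num

/-! ### Product measures -/

theorem lintegral_pi_prod {ι : Type*} [Fintype ι] {X : ι → Type*} [∀ i, MeasurableSpace (X i)]
    (μ : ∀ i, Measure (X i)) [∀ i, IsProbabilityMeasure (μ i)] {f : ∀ i, X i → ENNReal}
    (hf : ∀ i, Measurable (f i)) :
    ∫⁻ x, ∏ i, f i (x i) ∂(Measure.pi μ) = ∏ i, ∫⁻ x, f i x ∂(μ i) := by
  rw [lintegral_prod_eq_prod_lintegral_of_indepFun Finset.univ (fun i (x : ∀ i, X i) => f i (x i))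
    (iIndepFun_pi fun i => (hf i).aemeasurable) fun i => (hf i).comp (measurable_pi_apply i)]
  exact Finset.prod_congr rfl fun i _ => (measurePreserving_eval μ i).lintegral_comp (hf i)

/-- It suffices to compare boxes, where the indicator factors like the density. -/
theorem pi_withDensity {ι : Type*} [Fintype ι] {X : ι → Type*} [∀ i, MeasurableSpace (X i)]
    (μ : ∀ i, Measure (X i)) [∀ i, IsProbabilityMeasure (μ i)] {f : ∀ i, X i → ENNReal}
    (hf : ∀ i, Measurable (f i)) [∀ i, SigmaFinite ((μ i).withDensity (f i))] :
    Measure.pi (fun i => (μ i).withDensity (f i)) =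
      (Measure.pi μ).withDensity fun x => ∏ i, f i (x i) := by
  refine Measure.pi_eq fun s hs => ?_
  have hm : MeasurableSet (Set.univ.pi s) := .univ_pi hs
  rw [withDensity_apply _ hm, ← lintegral_indicator hm]
  have : ∀ x : ∀ i, X i, (Set.univ.pi s).indicator (fun x => ∏ i, f i (x i)) x =
      ∏ i, (s i).indicator (f i) (x i) := fun x => by
    classical
    by_cases h : x ∈ Set.univ.pi s
    · rw [Set.indicator_of_mem h]
      exact Finset.prod_congr rfl fun i _ => (Set.indicator_of_mem (h i trivial) _).symm
    · rw [Set.indicator_of_notMem h]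
      simp only [Set.mem_univ_pi, not_forall] at h
      obtain ⟨i, hi⟩ := h
      exact (Finset.prod_eq_zero (Finset.mem_univ i) (Set.indicator_of_notMem hi _)).symm
  simp_rw [this]
  rw [lintegral_pi_prod μ fun i => (hf i).indicator (hs i)]
  exact Finset.prod_congr rfl fun i _ => by
    rw [lintegral_indicator (hs i), withDensity_apply _ (hs i)]

/-- Both iterated products are curryings of one product over pairs of indices. This regroups the
noise by coordinate instead of by observation, since the random signs act coordinatewise. -/
theorem measurePreserving_pi_swap {ι κ X : Type*} [Fintype ι] [Fintype κ] [MeasurableSpace X]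
    (μ : Measure X) [IsProbabilityMeasure μ] :
    MeasurePreserving (fun (x : ι → κ → X) j i => x i j)
      (Measure.pi fun _ => Measure.pi fun _ => μ) (Measure.pi fun _ => Measure.pi fun _ => μ) := by
  refine ⟨by fun_prop, ?_⟩
  have h1 := Measure.infinitePi_map_curry (fun (_ : ι) (_ : κ) => μ)
  have h2 := Measure.infinitePi_map_curry (fun (_ : κ) (_ : ι) => μ)
  have h3 := Measure.pi_map_piCongrLeft (Equiv.prodComm ι κ) (fun _ => μ)
  simp only [Measure.infinitePi_eq_pi] at h1 h2
  rw [← h1, ← h2, ← h3, Measure.map_map (by fun_prop) (by fun_prop),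
    Measure.map_map (by fun_prop) (by fun_prop)]
  congr 1

/-! ### Shifts of Gaussian measures -/

/-- The density of `N(h, 1)` with respect to `N(0, 1)`. -/
noncomputable def shiftDensity (h x : ℝ) : ENNReal := ENNReal.ofReal (Real.exp (h * x - h ^ 2 / 2))

@[fun_prop]
theorem measurable_shiftDensity (h : ℝ) : Measurable (shiftDensity h) := by
  unfold shiftDensity; fun_prop

theorem gaussianReal_map_add_eq_withDensity (h : ℝ) :
    (gaussianReal 0 1).map (· + h) = (gaussianReal 0 1).withDensity (shiftDensity h) := by
  rw [gaussianReal_map_add_const, gaussianReal_of_var_ne_zero _ one_ne_zero,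
    gaussianReal_of_var_ne_zero _ one_ne_zero, ← withDensity_mul _ (by fun_prop) (by fun_prop)]
  congr 1
  ext x
  simp only [Pi.mul_apply, gaussianPDF, shiftDensity, gaussianPDFReal]
  rw [← ENNReal.ofReal_mul (by positivity), mul_assoc _ (Real.exp _), ← Real.exp_add]
  congr 3
  simp
  ring

theorem pi_gaussianReal_map_add {ι : Type*} [Fintype ι] (h : ι → ℝ) :
    (Measure.pi fun _ : ι => gaussianReal 0 1).map (· + h) =
      (Measure.pi fun _ : ι => gaussianReal 0 1).withDensity
        fun x => ∏ i, shiftDensity (h i) (x i) := by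
  have : ∀ i, IsProbabilityMeasure ((gaussianReal 0 1).withDensity (shiftDensity (h i))) :=
    fun i => by
      rw [← gaussianReal_map_add_eq_withDensity]
      exact Measure.isProbabilityMeasure_map (by fun_prop)
  rw [← pi_withDensity _ fun i => measurable_shiftDensity (h i)]
  simp_rw [← gaussianReal_map_add_eq_withDensity]
  rw [← Measure.pi_map_pi fun i => by fun_prop]
  rfl

/-! ### A symmetric two-point mixture of Gaussian vectors -/

theorem Label.toReal_one : Label.toReal 1 = 1 := by simp [Label.toReal]

theorem Label.toReal_neg (e : Label) : Label.toReal (-e) = -Label.toReal e := by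
  simp [Label.toReal]

theorem Label.toReal_sq (e : Label) : Label.toReal e ^ 2 = 1 := by
  rcases Int.units_eq_one_or e with rfl | rfl <;> simp [Label.toReal]

@[fun_prop]
theorem Label.measurable_toReal : Measurable Label.toReal := measurable_of_finite _

/-- The standard Gaussian law on `ℝⁿ × ℝ`: one coordinate of the noise of the training sample and
of the new observation. -/
noncomputable def coordNoise (n : ℕ) : Measure ((Fin n → ℝ) × ℝ) :=
  (Measure.pi fun _ => gaussianReal 0 1).prod (gaussianReal 0 1)

instance (n : ℕ) : IsProbabilityMeasure (coordNoise n) := by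
  unfold coordNoise; infer_instance

instance (p n : ℕ) : SFinite (Measure.pi fun _ : Fin p => coordNoise n) :=
  have : SigmaFinite (Measure.pi fun _ : Fin p => coordNoise n) := inferInstance
  inferInstance

/-- The linear form `x ↦ a ∑ ηᵢ xᵢ`. -/
noncomputable def trainForm {n : ℕ} (a : ℝ) (η : Fin n → Label) (x : Fin n → ℝ) : ℝ :=
  ∑ i, a * Label.toReal (η i) * x i

@[fun_prop]
theorem measurable_trainForm {n : ℕ} (a : ℝ) (η : Fin n → Label) :
    Measurable (trainForm a η) := by
  unfold trainForm; fun_prop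

theorem trainForm_neg {n : ℕ} (a : ℝ) (η : Fin n → Label) (x : Fin n → ℝ) :
    trainForm (-a) η x = -trainForm a η x := by
  simp [trainForm]

/-- The density of the mixture with equal weights of `N(± a (η, e), 1)` with respect to
`N(0, 1)` on `ℝⁿ × ℝ`. -/
noncomputable def mixDensity {n : ℕ} (a : ℝ) (η : Fin n → Label) (e : Label)
    (x : (Fin n → ℝ) × ℝ) : ENNReal :=
  ENNReal.ofReal (Real.exp (-((n + 1) * a ^ 2 / 2)) *
    Real.cosh (trainForm a η x.1 + a * Label.toReal e * x.2))

@[fun_prop]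
theorem measurable_mixDensity {n : ℕ} (a : ℝ) (η : Fin n → Label) (e : Label) :
    Measurable (mixDensity a η e) := by
  unfold mixDensity; fun_prop

theorem prod_shiftDensity {n : ℕ} (a : ℝ) (η : Fin n → Label) (e : Label)
    (x : (Fin n → ℝ) × ℝ) :
    (∏ i, shiftDensity (a * Label.toReal (η i)) (x.1 i)) * shiftDensity (a * Label.toReal e) x.2 =
      ENNReal.ofReal (Real.exp (-((n + 1) * a ^ 2 / 2)) *
        Real.exp (trainForm a η x.1 + a * Label.toReal e * x.2)) := by
  simp only [shiftDensity, trainForm]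
  rw [← ENNReal.ofReal_prod_of_nonneg fun _ _ => (Real.exp_pos _).le, ← Real.exp_sum,
    ← ENNReal.ofReal_mul (by positivity), ← Real.exp_add, ← Real.exp_add]
  congr 2
  simp only [mul_pow, Label.toReal_sq, Finset.sum_sub_distrib]
  simp
  ring

theorem coordNoise_map_shift {n : ℕ} (a : ℝ) (η : Fin n → Label) (e : Label) :
    (coordNoise n).map (fun x =>
      ((fun i => x.1 i + a * Label.toReal (η i)), x.2 + a * Label.toReal e)) =
      (coordNoise n).withDensity fun x => ENNReal.ofReal (Real.exp (-((n + 1) * a ^ 2 / 2)) *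
        Real.exp (trainForm a η x.1 + a * Label.toReal e * x.2)) := by
  simp_rw [← prod_shiftDensity]
  have h := Measure.map_prod_map (Measure.pi fun _ : Fin n => gaussianReal 0 1) (gaussianReal 0 1)
    (f := (· + fun i => a * Label.toReal (η i))) (g := (· + a * Label.toReal e))
    (by fun_prop) (by fun_prop)
  rw [pi_gaussianReal_map_add, gaussianReal_map_add_eq_withDensity,
    prod_withDensity (by fun_prop) (by fun_prop)] at h
  exact h.symm

/-- The tilts for the two signs have the same normalisation, because labels square to 1, so
averaging them turns exp into cosh. -/
theorem rademacher_prod_coordNoise_map {n : ℕ} (a : ℝ) (η : Fin n → Label) (e : Label) :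
    (rademacher.prod (coordNoise n)).map (fun x =>
      ((fun i => x.2.1 i + Label.toReal x.1 * a * Label.toReal (η i)),
        x.2.2 + Label.toReal x.1 * a * Label.toReal e)) =
      (coordNoise n).withDensity (mixDensity a η e) := by
  have hm : Measurable (fun x : Label × ((Fin n → ℝ) × ℝ) =>
      ((fun i => x.2.1 i + Label.toReal x.1 * a * Label.toReal (η i)),
        x.2.2 + Label.toReal x.1 * a * Label.toReal e)) := by fun_prop
  rw [rademacher, Measure.add_prod, Measure.prod_smul_left, Measure.prod_smul_left,
    Measure.dirac_prod, Measure.dirac_prod, Measure.map_add _ _ hm, Measure.map_smul,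
    Measure.map_smul, Measure.map_map hm (by fun_prop), Measure.map_map hm (by fun_prop)]
  have h1 := coordNoise_map_shift a η e
  have h2 := coordNoise_map_shift (-a) η e
  simp only [Function.comp_def, Label.toReal_neg, Label.toReal_one, one_mul, neg_one_mul]
  rw [h1, h2, ← withDensity_smul _ (by fun_prop), ← withDensity_smul _ (by fun_prop),
    ← withDensity_add_left (by fun_prop)]
  congr 1
  ext x
  have : (2⁻¹ : ENNReal) = ENNReal.ofReal 2⁻¹ := by
    rw [ENNReal.ofReal_inv_of_pos two_pos]; simp
  simp only [Pi.add_apply, Pi.smul_apply, smul_eq_mul, this, mixDensity]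
  rw [← ENNReal.ofReal_mul (by positivity), ← ENNReal.ofReal_mul (by positivity),
    ← ENNReal.ofReal_add (by positivity) (by positivity), Real.cosh_eq, trainForm_neg]
  congr 1
  ring_nf

instance {n : ℕ} (a : ℝ) (η : Fin n → Label) (e : Label) :
    IsProbabilityMeasure ((coordNoise n).withDensity (mixDensity a η e)) := by
  rw [← rademacher_prod_coordNoise_map]
  exact Measure.isProbabilityMeasure_map (by fun_prop)

/-! ### The Hellinger affinity of two mixtures -/

/-- Separates the training form from the new observation in the product of the two mixture
densities. -/
theorem cosh_add_mul_cosh_sub (x y : ℝ) :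
    Real.cosh (x + y) * Real.cosh (x - y) = Real.cosh x ^ 2 + Real.cosh y ^ 2 - 1 := by
  rw [Real.cosh_add, Real.cosh_sub]
  rw [show ∀ c d s t : ℝ, (c * d + s * t) * (c * d - s * t) = c ^ 2 * d ^ 2 - s ^ 2 * t ^ 2 by
    intros; ring, Real.sinh_sq, Real.sinh_sq]
  ring

/-- With w the root, (uv)² - w² = (u² - 1)(v² - 1), and (u + 1)(v + 1) ≤ 4uv ≤ 4(uv + w); divide by
uv + w. The lower bound is a combination of products of functions of independent variables, so its
integral is explicit. -/
theorem mul_sub_le_sqrt {u v : ℝ} (hu : 1 ≤ u) (hv : 1 ≤ v) :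
    u * v - 4 * ((u - 1) * (v - 1)) ≤ √(u ^ 2 + v ^ 2 - 1) := by
  have hw := Real.sq_sqrt (show 0 ≤ u ^ 2 + v ^ 2 - 1 by nlinarith)
  have hw0 := Real.sqrt_nonneg (u ^ 2 + v ^ 2 - 1)
  generalize √(u ^ 2 + v ^ 2 - 1) = w at *
  have huv : 0 < u * v := by positivity
  have hd : 0 ≤ (u - 1) * (v - 1) := mul_nonneg (by linarith) (by linarith)
  have h1 : (u + 1) * (v + 1) ≤ (2 * u) * (2 * v) :=
    mul_le_mul (by linarith) (by linarith) (by linarith) (by linarith)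
  have h2 : (u * v - w) * (u * v + w) = (u - 1) * (v - 1) * ((u + 1) * (v + 1)) := by
    linear_combination -hw
  have h3 : (u - 1) * (v - 1) * ((u + 1) * (v + 1)) ≤
      (4 * ((u - 1) * (v - 1))) * (u * v + w) := by
    nlinarith [mul_le_mul_of_nonneg_left h1 hd, mul_nonneg hd hw0]
  have := le_of_mul_le_mul_right (h2.trans_le h3) (by linarith)
  linarith

theorem integrable_exp_trainForm {n : ℕ} (a : ℝ) (η : Fin n → Label) :
    Integrable (fun x => Real.exp (trainForm a η x)) (Measure.pi fun _ => gaussianReal 0 1) := by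
  simp only [trainForm, Real.exp_sum]
  exact Integrable.fintype_prod fun i => integrable_exp_mul_gaussianReal _

theorem integral_exp_gaussianReal (t : ℝ) :
    ∫ x, Real.exp (t * x) ∂(gaussianReal 0 1) = Real.exp (t ^ 2 / 2) := by
  have := congrFun (mgf_id_gaussianReal (μ := 0) (v := 1)) t
  simpa [mgf] using this

theorem integral_exp_trainForm {n : ℕ} (a : ℝ) (η : Fin n → Label) :
    ∫ x, Real.exp (trainForm a η x) ∂(Measure.pi fun _ => gaussianReal 0 1) =
      Real.exp (n * a ^ 2 / 2) := by
  simp only [trainForm, Real.exp_sum]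
  rw [integral_fintype_prod_eq_prod (f := fun i x => Real.exp (a * Label.toReal (η i) * x))]
  simp_rw [integral_exp_gaussianReal, mul_pow, Label.toReal_sq, ← Real.exp_sum]
  simp
  ring

theorem integrable_cosh_trainForm {n : ℕ} (a : ℝ) (η : Fin n → Label) :
    Integrable (fun x => Real.cosh (trainForm a η x)) (Measure.pi fun _ => gaussianReal 0 1) := by
  simp only [Real.cosh_eq, ← trainForm_neg]
  exact ((integrable_exp_trainForm a η).add (integrable_exp_trainForm (-a) η)).div_const 2

theorem integral_cosh_trainForm {n : ℕ} (a : ℝ) (η : Fin n → Label) :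
    ∫ x, Real.cosh (trainForm a η x) ∂(Measure.pi fun _ => gaussianReal 0 1) =
      Real.exp (n * a ^ 2 / 2) := by
  simp only [Real.cosh_eq, ← trainForm_neg]
  rw [integral_div, integral_add (integrable_exp_trainForm a η) (integrable_exp_trainForm (-a) η),
    integral_exp_trainForm, integral_exp_trainForm]
  simp

theorem integrable_cosh_gaussianReal (a : ℝ) :
    Integrable (fun y => Real.cosh (a * y)) (gaussianReal 0 1) := by
  simp only [Real.cosh_eq, ← neg_mul]
  exact ((integrable_exp_mul_gaussianReal a).add (integrable_exp_mul_gaussianReal (-a))).div_const 2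

theorem integral_cosh_gaussianReal (a : ℝ) :
    ∫ y, Real.cosh (a * y) ∂(gaussianReal 0 1) = Real.exp (a ^ 2 / 2) := by
  simp only [Real.cosh_eq, ← neg_mul]
  rw [integral_div, integral_add (integrable_exp_mul_gaussianReal a)
    (integrable_exp_mul_gaussianReal (-a)), integral_exp_gaussianReal, integral_exp_gaussianReal]
  simp

/-- The Hellinger affinity of the mixtures for the labels `1` and `-1`. -/
noncomputable def mixAffinity {n : ℕ} (a : ℝ) (η : Fin n → Label) : ENNReal :=
  ∫⁻ x, mixDensity a η 1 x ^ (1 / 2 : ℝ) * mixDensity a η (-1) x ^ (1 / 2 : ℝ) ∂(coordNoise n)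

theorem sqrt_mixDensity_mul {n : ℕ} (a : ℝ) (η : Fin n → Label) (x : (Fin n → ℝ) × ℝ) :
    mixDensity a η 1 x ^ (1 / 2 : ℝ) * mixDensity a η (-1) x ^ (1 / 2 : ℝ) =
      ENNReal.ofReal (Real.exp (-((n + 1) * a ^ 2 / 2)) *
        √(Real.cosh (trainForm a η x.1) ^ 2 + Real.cosh (a * x.2) ^ 2 - 1)) := by
  rw [← ENNReal.mul_rpow_of_nonneg _ _ (by norm_num), mixDensity, mixDensity,
    ← ENNReal.ofReal_mul (by positivity), ENNReal.ofReal_rpow_of_nonneg (by positivity)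
    (by norm_num), ← Real.sqrt_eq_rpow, ← cosh_add_mul_cosh_sub, Label.toReal_neg,
    Label.toReal_one]
  congr 1
  rw [show ∀ s u v : ℝ, s * u * (s * v) = s ^ 2 * (u * v) by intros; ring,
    Real.sqrt_mul (by positivity), Real.sqrt_sq (by positivity)]
  ring_nf

theorem ofReal_integral_le_mixAffinity {n : ℕ} (a : ℝ) (η : Fin n → Label)
    {f : (Fin n → ℝ) × ℝ → ℝ} (hf : Integrable f (coordNoise n))
    (h : ∀ x, f x ≤ √(Real.cosh (trainForm a η x.1) ^ 2 + Real.cosh (a * x.2) ^ 2 - 1)) :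
    ENNReal.ofReal (Real.exp (-((n + 1) * a ^ 2 / 2)) * ∫ x, f x ∂(coordNoise n)) ≤
      mixAffinity a η := by
  rw [← integral_const_mul, mixAffinity]
  simp_rw [sqrt_mixDensity_mul]
  refine le_trans ?_ (lintegral_mono fun x => ENNReal.ofReal_le_ofReal
    (mul_le_mul_of_nonneg_left (h x) (Real.exp_pos _).le))
  have hi := hf.const_mul (Real.exp (-((n + 1) * a ^ 2 / 2)))
  -- The minorant may be negative, hence the passage to its positive part.
  refine (ENNReal.ofReal_le_ofReal (integral_mono hi hi.pos_part fun x => le_max_left _ 0)).trans ?_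
  rw [ofReal_integral_eq_lintegral_ofReal hi.pos_part (.of_forall fun x => le_max_right _ _)]
  refine lintegral_mono fun x => le_of_eq ?_
  rw [ENNReal.ofReal_max]
  simp

theorem exp_neg_half_sq_le_mixAffinity {n : ℕ} (a : ℝ) (η : Fin n → Label) :
    ENNReal.ofReal (Real.exp (-(a ^ 2 / 2))) ≤ mixAffinity a η := by
  refine le_trans (le_of_eq ?_) (ofReal_integral_le_mixAffinity a η
    (f := fun x => Real.cosh (trainForm a η x.1))
    ((integrable_cosh_trainForm a η).comp_fst _) fun x => ?_)
  · rw [coordNoise, integral_fun_fst (fun x => Real.cosh (trainForm a η x)),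
      integral_cosh_trainForm]
    simp [← Real.exp_add]
    ring_nf
  · refine Real.le_sqrt_of_sq_le ?_
    nlinarith [Real.one_le_cosh (a * x.2)]

theorem one_sub_le_mixAffinity {n : ℕ} (a : ℝ) (η : Fin n → Label) :
    ENNReal.ofReal (1 - n * a ^ 4) ≤ mixAffinity a η := by
  have i1 := integrable_cosh_trainForm a η
  have i2 := integrable_cosh_gaussianReal a
  have j1 : Integrable (fun x => Real.cosh (trainForm a η x) - 1) _ :=
    i1.sub (integrable_const 1)
  have j2 : Integrable (fun y => Real.cosh (a * y) - 1) _ := i2.sub (integrable_const 1)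
  refine le_trans (ENNReal.ofReal_le_ofReal ?_) (ofReal_integral_le_mixAffinity a η
    (f := fun x => Real.cosh (trainForm a η x.1) * Real.cosh (a * x.2) -
      4 * ((Real.cosh (trainForm a η x.1) - 1) * (Real.cosh (a * x.2) - 1)))
    ((i1.mul_prod i2).sub ((j1.mul_prod j2).const_mul 4)) fun x =>
      mul_sub_le_sqrt (Real.one_le_cosh _) (Real.one_le_cosh _))
  rw [coordNoise, integral_sub (i1.mul_prod i2) ((j1.mul_prod j2).const_mul 4),
    integral_const_mul, integral_prod_mul (fun x => Real.cosh (trainForm a η x))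
    (fun y => Real.cosh (a * y)), integral_prod_mul (fun x => Real.cosh (trainForm a η x) - 1)
    (fun y => Real.cosh (a * y) - 1), integral_sub i1 (integrable_const 1),
    integral_sub i2 (integrable_const 1), integral_cosh_trainForm, integral_cosh_gaussianReal]
  simp only [integral_const, probReal_univ, smul_eq_mul, mul_one]
  have e1 : Real.exp (-((n + 1) * a ^ 2 / 2)) * Real.exp (n * a ^ 2 / 2) =
    Real.exp (-(a ^ 2 / 2)) := by rw [← Real.exp_add]; ring_nf
  have e2 : Real.exp (-(a ^ 2 / 2)) * Real.exp (a ^ 2 / 2) = 1 := by rw [← Real.exp_add]; simp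
  have e3 : Real.exp (-((n + 1) * a ^ 2 / 2)) =
    Real.exp (-(n * a ^ 2 / 2)) * Real.exp (-(a ^ 2 / 2)) := by rw [← Real.exp_add]; ring_nf
  have e4 : Real.exp (-(n * a ^ 2 / 2)) * Real.exp (n * a ^ 2 / 2) = 1 := by
    rw [← Real.exp_add]; simp
  have f1 := Real.add_one_le_exp (-(n * a ^ 2 / 2))
  have f2 := Real.add_one_le_exp (-(a ^ 2 / 2))
  have g1 : Real.exp (-(n * a ^ 2 / 2)) ≤ 1 := Real.exp_le_one_iff.2 (by
    have : 0 ≤ n * a ^ 2 / 2 := by positivity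
    linarith)
  have g2 : Real.exp (-(a ^ 2 / 2)) ≤ 1 := Real.exp_le_one_iff.2 (by nlinarith [sq_nonneg a])
  rw [e3]
  generalize Real.exp (-(n * a ^ 2 / 2)) = s at *
  generalize Real.exp (-(a ^ 2 / 2)) = t at *
  generalize Real.exp (n * a ^ 2 / 2) = s' at *
  generalize Real.exp (a ^ 2 / 2) = t' at *
  -- Here s' = 1/s and t' = 1/t. Then 1 - exp(-z) ≤ z bounds the two factors by n a²/2 and a²/2,
  -- whose halves cancel the 4.
  have : s * t * (s' * t' - 4 * ((s' - 1) * (t' - 1))) = 1 - 4 * ((1 - s) * (1 - t)) := by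
    linear_combination (t * t' - 4 * t * (t' - 1)) * e4 + (1 - 4 * (1 - s)) * e2
  rw [this]
  have : (1 - s) * (1 - t) ≤ (n * a ^ 2 / 2) * (a ^ 2 / 2) :=
    mul_le_mul (by linarith) (by linarith) (by linarith) (by positivity)
  linarith

theorem exp_neg_le_mixAffinity {n : ℕ} (a : ℝ) (η : Fin n → Label) (h : n * a ^ 2 ≤ 1 / 2) :
    ENNReal.ofReal (Real.exp (-(2 * n * a ^ 2 * a ^ 2))) ≤ mixAffinity a η := by
  refine (ENNReal.ofReal_le_ofReal ?_).trans (one_sub_le_mixAffinity a η)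
  have hx0 : 0 ≤ n * a ^ 4 := by positivity
  -- For n ≥ 1 the hypothesis also gives a² ≤ 1/2. The bound exp(-2x) ≤ 1 - x used below needs x ≤
  -- 1/2.
  have hx : n * a ^ 4 ≤ 1 / 4 := by
    rcases Nat.eq_zero_or_pos n with rfl | hn
    · simp
    · have : (1 : ℝ) ≤ n := by exact_mod_cast hn
      nlinarith [sq_nonneg a]
  have : 2 * n * a ^ 2 * a ^ 2 = 2 * (n * a ^ 4) := by ring
  rw [this]
  generalize n * a ^ 4 = x at *
  rw [Real.exp_neg]
  refine inv_le_of_inv_le₀ (by linarith) ?_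
  refine le_trans ?_ (Real.add_one_le_exp _)
  rw [inv_le_iff_one_le_mul₀ (by linarith)]
  nlinarith

/-! ### Gaussian vectors with a diagonal covariance matrix -/

open scoped MatrixOrder in
theorem sqrt_diagonal_sq {p : ℕ} {d : Fin p → ℝ} (hd : ∀ j, 0 ≤ d j) :
    CFC.sqrt (Matrix.diagonal fun j => d j ^ 2) = Matrix.diagonal d := by
  refine CFC.sqrt_unique ?_ (Matrix.nonneg_iff_posSemidef.2 (Matrix.PosSemidef.diagonal hd))
  simp [Matrix.diagonal_mul_diagonal, sq]

/-- The vector with coordinates `d j * x j`. -/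
noncomputable def scale {p : ℕ} (d x : Fin p → ℝ) : Feature p := WithLp.toLp 2 fun j => d j * x j

@[fun_prop]
theorem measurable_scale {p : ℕ} (d : Fin p → ℝ) : Measurable (scale d) := by
  unfold scale; fun_prop

theorem measurePreserving_scale {p : ℕ} {d : Fin p → ℝ} (hd : ∀ j, 0 ≤ d j) :
    MeasurePreserving (scale d) (Measure.pi fun _ => gaussianReal 0 1)
      (multivariateGaussian 0 (Matrix.diagonal fun j => d j ^ 2)) := by
  refine ⟨by fun_prop, ?_⟩
  rw [multivariateGaussian, ← map_pi_eq_stdGaussian, sqrt_diagonal_sq hd,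
    Measure.map_map (by fun_prop) (by fun_prop)]
  congr 1
  ext x j
  simp [scale, Matrix.mulVec_diagonal]

/-- The noise of the training sample and of the new observation, built from its coordinates. -/
noncomputable def assemble {p n : ℕ} (d : Fin p → ℝ) (z : Fin p → (Fin n → ℝ) × ℝ) :
    (Fin n → Feature p) × Feature p :=
  (fun i => scale d fun j => (z j).1 i, scale d fun j => (z j).2)

@[fun_prop]
theorem measurable_assemble {p n : ℕ} (d : Fin p → ℝ) : Measurable (assemble (n := n) d) := by
  unfold assemble; fun_prop

theorem measurePreserving_assemble {p n : ℕ} {d : Fin p → ℝ} (hd : ∀ j, 0 ≤ d j) :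
    MeasurePreserving (assemble d) (Measure.pi fun _ : Fin p => coordNoise n)
      ((Measure.pi fun _ => multivariateGaussian 0 (Matrix.diagonal fun j => d j ^ 2)).prod
        (multivariateGaussian 0 (Matrix.diagonal fun j => d j ^ 2))) := by
  have h1 := measurePreserving_arrowProdEquivProdArrow (Fin n → ℝ) ℝ (Fin p)
    (fun _ => Measure.pi fun _ => gaussianReal 0 1) (fun _ => gaussianReal 0 1)
  have h2 := (measurePreserving_pi_swap (ι := Fin p) (κ := Fin n) (gaussianReal 0 1)).prod
    (.id (Measure.pi fun _ : Fin p => gaussianReal 0 1))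
  have h3 := (measurePreserving_pi (fun _ : Fin n => Measure.pi fun _ : Fin p => gaussianReal 0 1)
    (fun _ => multivariateGaussian 0 (Matrix.diagonal fun j => d j ^ 2))
    fun _ => measurePreserving_scale hd).prod (measurePreserving_scale hd)
  exact h3.comp (h2.comp h1)

/-! ### The risk averaged over a prior on the signals -/

/-- The probability of an error on a new observation with label `e`, for training labels `η`. -/
noncomputable def errorProb {p n : ℕ} (f : Classifier p n) (S : Matrix (Fin p) (Fin p) ℝ)
    (θ : Feature p) (η : Fin n → Label) (e : Label) : ENNReal :=
  ((Measure.pi fun _ : Fin n => multivariateGaussian 0 S).prod (multivariateGaussian 0 S))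
    {x | f.1 (mixSample θ (η, x.1), Label.toReal e • θ + x.2) ≠ e}

theorem measurableSet_error {α : Type*} [MeasurableSpace α] {g : α → Label} (hg : Measurable g)
    (e : Label) : MeasurableSet {x | g x ≠ e} :=
  (measurableSet_eq_fun hg measurable_const).compl

theorem condRisk_eq {p n : ℕ} (f : Classifier p n) (S : Matrix (Fin p) (Fin p) ℝ)
    (θ : Feature p) (D : Sample p n) :
    condRisk f S θ D =
      2⁻¹ * (multivariateGaussian 0 S {w | f.1 (D, Label.toReal 1 • θ + w) ≠ 1} +
        multivariateGaussian 0 S {w | f.1 (D, Label.toReal (-1) • θ + w) ≠ -1}) := by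
  have hf := f.2
  have hs : MeasurableSet {z : Feature p × Label | f.1 (D, z.1) ≠ z.2} :=
    (measurableSet_eq_fun (hf.comp (by fun_prop)) measurable_snd).compl
  rw [condRisk, testLaw, Measure.map_apply (measurable_mixPoint θ) hs, rademacher,
    Measure.add_prod, Measure.prod_smul_left, Measure.prod_smul_left, Measure.dirac_prod,
    Measure.dirac_prod, Measure.add_apply, Measure.smul_apply, Measure.smul_apply,
    Measure.map_apply (by fun_prop) (measurable_mixPoint θ hs),
    Measure.map_apply (by fun_prop) (measurable_mixPoint θ hs), smul_eq_mul, smul_eq_mul,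
    ← mul_add]
  rfl

theorem expRisk_eq {p n : ℕ} (ν : Measure (Fin n → Label)) [IsProbabilityMeasure ν]
    (f : Classifier p n) (S : Matrix (Fin p) (Fin p) ℝ) (θ : Feature p) :
    expRisk ν f S θ = ∫⁻ η, 2⁻¹ * (errorProb f S θ η 1 + errorProb f S θ η (-1)) ∂ν := by
  have hf := f.2
  have hms := measurable_mixSample (n := n) θ
  have hs : ∀ e : Label, MeasurableSet
      {x : Sample p n × Feature p | f.1 (x.1, Label.toReal e • θ + x.2) ≠ e} :=
    fun e => measurableSet_error (hf.comp (by fun_prop)) e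
  have hm : ∀ e : Label, Measurable fun D : Sample p n =>
      multivariateGaussian 0 S {w | f.1 (D, Label.toReal e • θ + w) ≠ e} :=
    fun e => measurable_measure_prodMk_left (hs e)
  have hc : Measurable fun D : Sample p n => condRisk f S θ D := by
    simp_rw [condRisk_eq]
    exact ((hm 1).add (hm (-1))).const_mul _
  have hcm : Measurable fun x => condRisk f S θ (mixSample θ x) := hc.comp hms
  rw [expRisk, trainLaw, lintegral_map hc hms, lintegral_prod _ hcm.aemeasurable]
  refine lintegral_congr fun η => ?_
  have hη : Measurable fun W : Fin n → Feature p => mixSample θ (η, W) :=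
    hms.comp (by fun_prop)
  have he : ∀ e : Label, ∫⁻ W, multivariateGaussian 0 S
      {w | f.1 (mixSample θ (η, W), Label.toReal e • θ + w) ≠ e}
        ∂(Measure.pi fun _ : Fin n => multivariateGaussian 0 S) = errorProb f S θ η e := fun e => by
    rw [errorProb, Measure.prod_apply]
    · rfl
    · exact measurableSet_error (hf.comp (by fun_prop)) e
  have hmη : ∀ e : Label, Measurable fun W : Fin n → Feature p =>
      multivariateGaussian 0 S {w | f.1 (mixSample θ (η, W), Label.toReal e • θ + w) ≠ e} :=
    fun e => (hm e).comp hη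
  have hsum : Measurable fun W : Fin n → Feature p =>
      multivariateGaussian 0 S {w | f.1 (mixSample θ (η, W), Label.toReal 1 • θ + w) ≠ 1} +
      multivariateGaussian 0 S {w | f.1 (mixSample θ (η, W), Label.toReal (-1) • θ + w) ≠ -1} :=
    (hmη 1).add (hmη (-1))
  simp_rw [condRisk_eq]
  rw [lintegral_const_mul _ hsum, lintegral_add_left (hmη 1), he, he]

/-- The classifier as a function of the coordinates of the noise, in the absence of a signal. -/
noncomputable def coordClassifier {p n : ℕ} (f : Classifier p n) (d : Fin p → ℝ)
    (η : Fin n → Label) (z : Fin p → (Fin n → ℝ) × ℝ) : Label :=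
  f.1 (fun i => ((assemble d z).1 i, η i), (assemble d z).2)

theorem measurable_coordClassifier {p n : ℕ} (f : Classifier p n) (d : Fin p → ℝ)
    (η : Fin n → Label) : Measurable (coordClassifier f d η) := by
  have hf := f.2
  have := measurable_assemble (n := n) d
  exact hf.comp (by fun_prop)

/-- The signal with coordinates `± d j * a j`. -/
noncomputable def signSignal {p : ℕ} (d a : Fin p → ℝ) (ε : Fin p → Label) : Feature p :=
  scale d fun j => Label.toReal (ε j) * a j

/-- The coordinates of the noise after the shift by a signal. -/
noncomputable def shift {p n : ℕ} (a : Fin p → ℝ) (η : Fin n → Label) (e : Label)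
    (x : (Fin p → Label) × (Fin p → (Fin n → ℝ) × ℝ)) : Fin p → (Fin n → ℝ) × ℝ :=
  fun j => ((fun i => (x.2 j).1 i + Label.toReal (x.1 j) * a j * Label.toReal (η i)),
    (x.2 j).2 + Label.toReal (x.1 j) * a j * Label.toReal e)

@[fun_prop]
theorem measurable_shift {p n : ℕ} (a : Fin p → ℝ) (η : Fin n → Label) (e : Label) :
    Measurable (shift a η e) := by
  unfold shift; fun_prop

/-- The signal carries the same factor `d j` as the noise, so adding it amounts to translating the
standard coordinates. -/
theorem errorProb_signSignal {p n : ℕ} (f : Classifier p n) {d : Fin p → ℝ} (hd : ∀ j, 0 ≤ d j)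
    (a : Fin p → ℝ) (ε : Fin p → Label) (η : Fin n → Label) (e : Label) :
    errorProb f (Matrix.diagonal fun j => d j ^ 2) (signSignal d a ε) η e =
      (Measure.pi fun _ => coordNoise n) {z | coordClassifier f d η (shift a η e (ε, z)) ≠ e} := by
  have hf := f.2
  have hms := measurable_mixSample (n := n) (signSignal d a ε)
  rw [errorProb, ← (measurePreserving_assemble hd).measure_preimage]
  · congr 1
    ext z
    have h1 : mixSample (signSignal d a ε) (η, (assemble d z).1) =
        fun i => ((assemble d (shift a η e (ε, z))).1 i, η i) := by
      ext i
      · simp [mixSample, signSignal, assemble, shift, scale]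
        ring
      · simp [mixSample]
    have h2 : Label.toReal e • signSignal d a ε + (assemble d z).2 =
        (assemble d (shift a η e (ε, z))).2 := by
      ext j
      simp [signSignal, assemble, shift, scale]
      ring
    simp only [Set.mem_preimage, Set.mem_ofPred_eq, h1, h2, coordClassifier]
  · exact (measurableSet_error (hf.comp (by fun_prop)) e).nullMeasurableSet

/-- Independence of the signs makes the averaged law a product over coordinates. -/
theorem map_shift {p n : ℕ} (a : Fin p → ℝ) (η : Fin n → Label) (e : Label) :
    ((Measure.pi fun _ => rademacher).prod (Measure.pi fun _ => coordNoise n)).map (shift a η e) =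
      (Measure.pi fun _ => coordNoise n).withDensity
        fun z => ∏ j, mixDensity (a j) η e (z j) := by
  have h := (measurePreserving_arrowProdEquivProdArrow Label ((Fin n → ℝ) × ℝ) (Fin p)
    (fun _ => rademacher) fun _ => coordNoise n).symm
  rw [← pi_withDensity _ fun j => measurable_mixDensity (a j) η e]
  simp_rw [← rademacher_prod_coordNoise_map]
  rw [← Measure.pi_map_pi fun j => by fun_prop, ← h.map_eq,
    Measure.map_map (by fun_prop) h.measurable]
  rfl

theorem lintegral_errorProb_signSignal {p n : ℕ} (f : Classifier p n) {d : Fin p → ℝ}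
    (hd : ∀ j, 0 ≤ d j) (a : Fin p → ℝ) (η : Fin n → Label) (e : Label) :
    ∫⁻ ε, errorProb f (Matrix.diagonal fun j => d j ^ 2) (signSignal d a ε) η e
        ∂(Measure.pi fun _ => rademacher) =
      ((Measure.pi fun _ => coordNoise n).withDensity fun z => ∏ j, mixDensity (a j) η e (z j))
        {z | coordClassifier f d η z ≠ e} := by
  have hg := measurable_coordClassifier f d η
  have hs := (measurable_shift a η e) (measurableSet_error hg e)
  rw [← map_shift, Measure.map_apply (by fun_prop) (measurableSet_error hg e)]
  refine (lintegral_congr fun ε => errorProb_signSignal f hd a ε η e).trans ?_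
  exact (Measure.prod_apply (μ := Measure.pi fun _ : Fin p => rademacher)
    (ν := Measure.pi fun _ : Fin p => coordNoise n) hs).symm

theorem sq_prod_mixAffinity_le {p n : ℕ} (a : Fin p → ℝ) (η : Fin n → Label)
    {g : (Fin p → (Fin n → ℝ) × ℝ) → Label} (hg : Measurable g) :
    (∏ j, mixAffinity (a j) η) ^ 2 ≤
      2 * (((Measure.pi fun _ => coordNoise n).withDensity
          fun z => ∏ j, mixDensity (a j) η 1 (z j)) {z | g z ≠ 1} +
        ((Measure.pi fun _ => coordNoise n).withDensity
          fun z => ∏ j, mixDensity (a j) η (-1) (z j)) {z | g z ≠ -1}) := by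
  have hm : ∀ e, Measurable fun z : Fin p → (Fin n → ℝ) × ℝ => ∏ j, mixDensity (a j) η e (z j) :=
    fun e => by fun_prop
  have h1 : ∀ e, ∫⁻ z, ∏ j, mixDensity (a j) η e (z j)
      ∂(Measure.pi fun _ : Fin p => coordNoise n) ≤ 1 := fun e => by
    rw [← setLIntegral_univ, ← withDensity_apply _ .univ,
      ← pi_withDensity _ fun j => measurable_mixDensity (a j) η e]
    exact prob_le_one
  -- With only two labels, the two error events are complementary, as for a test.
  have hA : {z | g z ≠ -1} = {z | g z ≠ 1}ᶜ := by
    ext z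
    rcases Int.units_eq_one_or (g z) with h | h <;> simp [h]
  rw [hA]
  refine le_trans (le_of_eq ?_)
    (sq_lintegral_sqrt_mul_le (hm 1) (hm (-1)) (h1 1) (h1 (-1)) (measurableSet_error hg 1))
  simp_rw [← ENNReal.prod_rpow_of_nonneg (show (0 : ℝ) ≤ 1 / 2 by norm_num),
    ← Finset.prod_mul_distrib]
  rw [lintegral_pi_prod (fun _ => coordNoise n) (f := fun j x =>
    mixDensity (a j) η 1 x ^ (1 / 2 : ℝ) * mixDensity (a j) η (-1) x ^ (1 / 2 : ℝ))
    fun j => by fun_prop]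
  rfl

theorem le_lintegral_expRisk {p n : ℕ} (ν : Measure (Fin n → Label)) [IsProbabilityMeasure ν]
    (f : Classifier p n) {d : Fin p → ℝ} (hd : ∀ j, 0 ≤ d j) (a : Fin p → ℝ) {b : ENNReal}
    (hb : ∀ η : Fin n → Label, b ≤ ∏ j, mixAffinity (a j) η) :
    4⁻¹ * b ^ 2 ≤ ∫⁻ ε, expRisk ν f (Matrix.diagonal fun j => d j ^ 2) (signSignal d a ε)
      ∂(Measure.pi fun _ => rademacher) := by
  simp_rw [expRisk_eq]
  -- Averaging over the signs first, at fixed training labels, allows a bound uniform in η.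
  rw [lintegral_lintegral_swap (measurable_of_finite _).aemeasurable]
  have : ∀ η, 4⁻¹ * b ^ 2 ≤ ∫⁻ ε, 2⁻¹ *
      (errorProb f (Matrix.diagonal fun j => d j ^ 2) (signSignal d a ε) η 1 +
        errorProb f (Matrix.diagonal fun j => d j ^ 2) (signSignal d a ε) η (-1))
        ∂(Measure.pi fun _ => rademacher) := fun η => by
    rw [lintegral_const_mul _ (measurable_of_finite _),
      lintegral_add_left (measurable_of_finite _), lintegral_errorProb_signSignal f hd,
      lintegral_errorProb_signSignal f hd]
    have h := sq_prod_mixAffinity_le a η (measurable_coordClassifier f d η)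
    calc 4⁻¹ * b ^ 2 ≤ 4⁻¹ * (2 * _) := by
          gcongr 4⁻¹ * ?_
          exact (pow_le_pow_left' (hb η) 2).trans h
      _ = _ := by
          rw [← mul_assoc]
          congr 1
          rw [← ENNReal.toReal_eq_toReal_iff' (by finiteness) (by simp)]
          simp
          norm_num
  calc 4⁻¹ * b ^ 2 = ∫⁻ _, 4⁻¹ * b ^ 2 ∂ν := by simp
    _ ≤ _ := lintegral_mono this

/-! ### The effective rank -/

theorem specNorm_diagonal {p : ℕ} {v : Fin p → ℝ} {l : ℝ} {j : Fin p} (hj : v j = l)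
    (hv : ∀ i, v i ≤ l) : specNorm (Matrix.diagonal v) = l := by
  rw [specNorm, spectrum_diagonal]
  have : IsGreatest (Set.range v) l := ⟨⟨j, hj⟩, by rintro _ ⟨i, rfl⟩; exact hv i⟩
  exact this.csSup_eq

theorem effRank_sq_eq {p : ℕ} {S : Matrix (Fin p) (Fin p) ℝ} (hS : S.IsHermitian) :
    effRank (S ^ 2) =
      (∑ i, hS.eigenvalues i ^ 2) / sSup (Set.range fun i => hS.eigenvalues i ^ 2) := by
  have h : S ^ 2 = Unitary.conjStarAlgAut ℝ _ hS.eigenvectorUnitary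
      (Matrix.diagonal fun i => hS.eigenvalues i ^ 2) := by
    conv_lhs => rw [hS.spectral_theorem, ← map_pow, Matrix.diagonal_pow]
    rfl
  rw [effRank, specNorm, h]
  congr 1
  · rw [Unitary.conjStarAlgAut_apply, Matrix.trace_mul_comm, ← mul_assoc]
    simp [Matrix.trace]
  · rw [AlgEquiv.spectrum_eq, spectrum_diagonal]

/-- Positive definiteness makes all eigenvalues positive, so for p ≥ 2 the trace strictly exceeds
its largest term. The strict inequality is what later guarantees k ≥ 1. -/
theorem effRank_sq_bounds {p : ℕ} {S : Matrix (Fin p) (Fin p) ℝ} (hS : S.PosDef)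
    (hr : 0 < effRank (S ^ 2)) :
    1 ≤ p ∧ effRank (S ^ 2) ≤ p ∧ (1 < effRank (S ^ 2) ∨ p = 1 ∧ effRank (S ^ 2) = 1) := by
  have hpos := hS.eigenvalues_pos
  rw [effRank_sq_eq hS.1] at *
  generalize hS.1.eigenvalues = μ at *
  rcases Nat.eq_zero_or_pos p with rfl | hp
  · simp at hr
  have : Nonempty (Fin p) := ⟨⟨0, hp⟩⟩
  obtain ⟨j, hj⟩ := Finite.exists_max fun i => μ i ^ 2
  have hsup : sSup (Set.range fun i => μ i ^ 2) = μ j ^ 2 :=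
    IsGreatest.csSup_eq ⟨⟨j, rfl⟩, by rintro _ ⟨i, rfl⟩; exact hj i⟩
  have hm : 0 < μ j ^ 2 := pow_pos (hpos j) 2
  rw [hsup]
  refine ⟨hp, ?_, ?_⟩
  · rw [div_le_iff₀ hm]
    calc ∑ i, μ i ^ 2 ≤ ∑ _i : Fin p, μ j ^ 2 := Finset.sum_le_sum fun i _ => hj i
      _ = p * μ j ^ 2 := by simp
  · rcases Nat.eq_or_lt_of_le hp with h1 | h1
    · right
      obtain rfl : p = 1 := h1.symm
      rw [Fin.sum_univ_one, ← Subsingleton.elim j 0]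
      exact ⟨rfl, div_self hm.ne'⟩
    · left
      rw [one_lt_div hm]
      have : Nontrivial (Fin p) := Fin.nontrivial_iff_two_le.2 h1
      obtain ⟨i, hi⟩ := exists_ne j
      exact Finset.single_lt_sum hi (Finset.mem_univ j) (Finset.mem_univ i) (pow_pos (hpos i) 2)
        fun k _ _ => sq_nonneg _

/-- A nonempty class of covariance matrices contains a diagonal matrix whose top eigenvalue has
multiplicity comparable with the effective rank. -/
theorem exists_diagonal_mem_covClass {p : ℕ} {lam r : ℝ} (hlam : 0 < lam) (hr : 0 < r)
    (h : (covClass p lam r).Nonempty) :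
    ∃ (d : Fin p → ℝ) (T : Finset (Fin p)), (∀ j, 0 ≤ d j) ∧ (∀ j ∈ T, d j ^ 2 = lam) ∧
      T.Nonempty ∧ r ≤ 2 * T.card ∧ (Matrix.diagonal fun j => d j ^ 2) ∈ covClass p lam r := by
  obtain ⟨S, hS, -, rfl⟩ := h
  obtain ⟨hp, hrp, hr1⟩ := effRank_sq_bounds hS hr
  generalize effRank (S ^ 2) = r at *
  -- k is p if r = p, and ⌈r⌉ - 1 otherwise. The floor would fail for integer r < p: the remaining
  -- eigenvalues would have to vanish. From r ≤ k + 1 and k ≥ 1 follows r ≤ 2k.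
  obtain ⟨k, hk1, hkp, hrk, hkr, hk⟩ : ∃ k : ℕ, 1 ≤ k ∧ k ≤ p ∧ r ≤ 2 * k ∧
      (k < p → (k : ℝ) < r) ∧ (k = p → r = k) ∧ r ≤ k + 1 := by
    rcases hr1 with h1 | ⟨rfl, rfl⟩
    · by_cases hrp' : r = p
      · exact ⟨p, hp, le_rfl, by linarith, fun h => absurd h (lt_irrefl _), fun _ => hrp',
          by linarith⟩
      · have hc1 : r ≤ ⌈r⌉₊ := Nat.le_ceil r
        have hc2 : (⌈r⌉₊ : ℝ) < r + 1 := Nat.ceil_lt_add_one hr.le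
        have hc3 : ⌈r⌉₊ ≤ p := Nat.ceil_le.2 hrp
        have hc4 : 1 < ⌈r⌉₊ := Nat.lt_ceil.2 (by exact_mod_cast h1)
        have hcast : ((⌈r⌉₊ - 1 : ℕ) : ℝ) = ⌈r⌉₊ - 1 := by
          rw [Nat.cast_sub hc4.le, Nat.cast_one]
        have hk1 : (1 : ℝ) ≤ ((⌈r⌉₊ - 1 : ℕ) : ℝ) := by exact_mod_cast (by omega : 1 ≤ ⌈r⌉₊ - 1)
        exact ⟨⌈r⌉₊ - 1, by omega, by omega, by linarith, fun _ => by linarith,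
          fun h => by omega, by linarith⟩
    · exact ⟨1, le_rfl, le_rfl, by norm_num, fun h => absurd h (lt_irrefl _), fun _ => by simp,
        by norm_num⟩
  -- The remaining p - k eigenvalues are `lam * s`, with s fixed by k + (p - k)s² = r. If k = p, the
  -- quotient is 0/0 = 0 and no eigenvalue uses it.
  set s : ℝ := √((r - k) / (p - k)) with hs
  have hs1 : s ≤ 1 := by
    rw [hs, Real.sqrt_le_one]
    exact div_le_one_of_le₀ (by linarith) (by
      have : (k : ℝ) ≤ p := by exact_mod_cast hkp
      linarith)
  have hs0 : k < p → 0 < s := fun h => Real.sqrt_pos.2 (div_pos (by linarith [hkr h]) (by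
    have : (k : ℝ) < p := by exact_mod_cast h
    linarith))
  have hs2 : k + (p - k) * s ^ 2 = r := by
    rcases hkp.eq_or_lt with h | h
    · rw [hk.1 h, h]; simp
    · have h' : (k : ℝ) < p := by exact_mod_cast h
      rw [hs, Real.sq_sqrt (div_nonneg (by linarith [hkr h]) (by linarith))]
      field_simp [(sub_pos.2 h').ne']
      ring
  set v : Fin p → ℝ := fun j => if (j : ℕ) < k then lam else lam * s with hv
  have hvpos : ∀ j, 0 < v j := fun j => by
    simp only [hv]
    split_ifs with hj
    · exact hlam
    · exact mul_pos hlam (hs0 (by omega))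
  have hvle : ∀ j, v j ≤ lam := fun j => by
    simp only [hv]
    split_ifs
    · exact le_rfl
    · exact mul_le_of_le_one_right hlam.le hs1
  have hd2 : (fun j => √(v j) ^ 2) = v := funext fun j => Real.sq_sqrt (hvpos j).le
  have hcard : (Finset.univ.filter fun j : Fin p => (j : ℕ) < k).card = k := by
    rw [Fin.card_filter_val_lt]
    omega
  refine ⟨fun j => √(v j), Finset.univ.filter fun j => (j : ℕ) < k, fun j => Real.sqrt_nonneg _,
    fun j hj => ?_, ?_, ?_, ?_⟩
  · rw [Real.sq_sqrt (hvpos j).le]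
    simp only [Finset.mem_filter] at hj
    simp [hv, hj.2]
  · rw [← Finset.card_pos, hcard]; omega
  · rwa [hcard]
  · have hv0 : v ⟨0, hp⟩ = lam := if_pos (Nat.lt_of_lt_of_le Nat.zero_lt_one hk1)
    rw [hd2]
    refine ⟨Matrix.PosDef.diagonal hvpos, specNorm_diagonal hv0 hvle, ?_⟩
    rw [Matrix.diagonal_pow, effRank,
      specNorm_diagonal (v := v ^ 2) (l := lam ^ 2) (j := ⟨0, hp⟩) (by simp [hv0])
        fun i => pow_le_pow_left₀ (hvpos i).le (hvle i) 2, div_eq_iff (by positivity), ← hs2]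
    have hsum : (Matrix.diagonal (v ^ 2)).trace =
        ∑ j : Fin p, if (j : ℕ) < k then lam ^ 2 else lam ^ 2 * s ^ 2 := by
      rw [Matrix.trace_diagonal]
      refine Finset.sum_congr rfl fun j _ => ?_
      simp only [Pi.pow_apply, hv]
      split_ifs <;> ring
    have hcard' : ((Finset.univ.filter fun j : Fin p => ¬(j : ℕ) < k).card : ℝ) = p - k := by
      have := Finset.card_filter_add_card_filter_not (s := (Finset.univ : Finset (Fin p)))
        fun j : Fin p => (j : ℕ) < k
      rw [hcard, Finset.card_univ, Fintype.card_fin] at this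
      rw [← this, Nat.cast_add, add_sub_cancel_left]
      congr!
    rw [hsum, Finset.sum_ite, Finset.sum_const, Finset.sum_const, hcard, nsmul_eq_mul,
      nsmul_eq_mul, hcard']
    ring

/-! ### The minimax bound -/

theorem norm_sq_signSignal {p : ℕ} {d : Fin p → ℝ} {T : Finset (Fin p)} {lam : ℝ}
    (hT : ∀ j ∈ T, d j ^ 2 = lam) (a : ℝ) (ε : Fin p → Label) :
    ‖signSignal d (fun j => if j ∈ T then a else 0) ε‖ ^ 2 = T.card * a ^ 2 * lam := by
  rw [EuclideanSpace.real_norm_sq_eq]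
  have : ∀ j, signSignal d (fun j => if j ∈ T then a else 0) ε j ^ 2 =
      if j ∈ T then a ^ 2 * lam else 0 := fun j => by
    simp only [signSignal, scale]
    split_ifs with h
    · rw [mul_pow, mul_pow, hT j h, Label.toReal_sq]; ring
    · simp
  simp_rw [this]
  simp [mul_assoc]

theorem ofReal_exp_le_prod_mixAffinity {p n : ℕ} (T : Finset (Fin p)) {a x : ℝ}
    (η : Fin n → Label) (h : ENNReal.ofReal (Real.exp (-(x * a ^ 2))) ≤ mixAffinity a η) :
    ENNReal.ofReal (Real.exp (-(x * (T.card * a ^ 2)))) ≤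
      ∏ j, mixAffinity (if j ∈ T then a else 0) η := by
  have h0 : ∀ j, ENNReal.ofReal (if j ∈ T then Real.exp (-(x * a ^ 2)) else 1) ≤
      mixAffinity (if j ∈ T then a else 0) η := fun j => by
    split_ifs
    · exact h
    -- Coordinates without signal cost nothing.
    · simpa using exp_neg_half_sq_le_mixAffinity 0 η
  refine le_trans (le_of_eq ?_) (Finset.prod_le_prod' fun j _ => h0 j)
  rw [← ENNReal.ofReal_prod_of_nonneg fun j _ => by split_ifs <;> positivity]
  congr 1
  rw [Finset.prod_ite_mem, Finset.univ_inter, Finset.prod_const, ← Real.exp_nat_mul]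
  ring_nf

/-- x is the cost per unit of a². If nΔ²/k ≤ 1/2, then 4nΔ⁴/k · (Δ² + r/n) ≤ 2Δ⁴ + 8Δ⁴, whence the
10. Otherwise r ≤ 2k < 4nΔ², and Δ²(Δ² + r/n) ≤ 5Δ⁴. -/
theorem exists_rate {n k : ℕ} {Δ r : ℝ} (hn : 1 ≤ n) (hk : 1 ≤ k) (hΔ : 0 < Δ) (hr : 0 < r)
    (hrk : r ≤ 2 * k) :
    ∃ x : ℝ, 2 * x * Δ ^ 2 ≤ 10 * (Δ ^ 4 / (Δ ^ 2 + r / n)) ∧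
      (x = 1 / 2 ∨ x = 2 * n * (Δ ^ 2 / k) ∧ n * (Δ ^ 2 / k) ≤ 1 / 2) := by
  have hn' : (0 : ℝ) < n := by exact_mod_cast hn
  have hk' : (0 : ℝ) < k := by exact_mod_cast hk
  have hD : 0 < Δ ^ 2 + r / n := by positivity
  by_cases h : n * (Δ ^ 2 / k) ≤ 1 / 2
  · refine ⟨_, ?_, .inr ⟨rfl, h⟩⟩
    rw [← mul_div_assoc 10, le_div_iff₀ hD]
    have h1 : r / n * (n * (Δ ^ 2 / k)) ≤ 2 * Δ ^ 2 := by
      have : r / n * (n * (Δ ^ 2 / k)) = r / k * Δ ^ 2 := by field_simp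
      rw [this]
      exact mul_le_mul_of_nonneg_right ((div_le_iff₀ hk').2 hrk) (sq_nonneg _)
    have h2 := mul_le_mul_of_nonneg_left h1 (sq_nonneg Δ)
    have h3 := mul_le_mul_of_nonneg_left h (sq_nonneg (Δ ^ 2))
    linear_combination 4 * h2 + 4 * h3
  · refine ⟨1 / 2, ?_, .inl rfl⟩
    rw [← mul_div_assoc 10, le_div_iff₀ hD]
    have h1 : r / n ≤ 4 * Δ ^ 2 := by
      rw [div_le_iff₀ hn']
      rw [not_le, ← mul_div_assoc, lt_div_iff₀ hk'] at h
      nlinarith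
    nlinarith [sq_nonneg Δ]

end GaussianMixture

theorem mainTheorem1 :
    ∃ c C : ℝ, 0 < c ∧ 0 < C ∧
      ∀ (p n : ℕ), 1 ≤ n →
      ∀ (Δ lam r : ℝ), 0 < Δ → 0 < lam → 0 < r →
      (GaussianMixture.covClass p lam r).Nonempty →
      ∀ (ν : Measure (Fin n → GaussianMixture.Label)), IsProbabilityMeasure ν →
        ENNReal.ofReal (C * Real.exp (-(c * (Δ ^ 4 / (Δ ^ 2 + r / (n : ℝ)))))) ≤
          GaussianMixture.minimaxRisk p n ν Δ lam r := by
  -- 10 is the constant of `exists_rate`, 1/4 that of `le_lintegral_expRisk`.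
  refine ⟨10, 1 / 4, by norm_num, by norm_num, fun p n hn Δ lam r hΔ hlam hr hne ν hν => ?_⟩
  open GaussianMixture in
  obtain ⟨d, T, hd, hT, hTne, hrT, hmem⟩ := exists_diagonal_mem_covClass hlam hr hne
  have hT1 : 1 ≤ T.card := hTne.card_pos
  have hT0 : (0 : ℝ) < T.card := by exact_mod_cast hT1
  obtain ⟨x, hx, hx'⟩ := exists_rate hn hT1 hΔ hr hrT
  set a : ℝ := Δ / √T.card with ha
  have ha2 : a ^ 2 = Δ ^ 2 / T.card := by rw [ha, div_pow, Real.sq_sqrt hT0.le]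
  have hTa : T.card * a ^ 2 = Δ ^ 2 := by rw [ha2]; field_simp
  have haff : ∀ η : Fin n → Label,
      ENNReal.ofReal (Real.exp (-(x * a ^ 2))) ≤ mixAffinity a η := fun η => by
    rcases hx' with rfl | ⟨rfl, h⟩
    · rw [one_div_mul_eq_div]
      exact exp_neg_half_sq_le_mixAffinity a η
    · rw [← ha2] at h ⊢
      exact exp_neg_le_mixAffinity a η h
  refine le_iInf fun f => ?_
  have key := le_lintegral_expRisk ν f hd (fun j => if j ∈ T then a else 0)
    fun η => ofReal_exp_le_prod_mixAffinity T η (haff η)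
  rw [hTa] at key
  -- Every signal of the prior is admissible, so the supremum dominates the average.
  have hsup : ∀ ε, expRisk ν f (Matrix.diagonal fun j => d j ^ 2)
      (signSignal d (fun j => if j ∈ T then a else 0) ε) ≤
      ⨆ S ∈ covClass p lam r, ⨆ θ ∈ signalClass p Δ lam, expRisk ν f S θ := fun ε => by
    refine le_iSup₂_of_le _ hmem (le_iSup₂_of_le _ ?_ le_rfl)
    rw [signalClass, Set.mem_ofPred_eq, norm_sq_signSignal hT, hTa]
  refine le_trans ?_ (key.trans ((lintegral_mono hsup).trans (by simp)))
  rw [← ENNReal.ofReal_pow (Real.exp_pos _).le, ← Real.exp_nat_mul,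
    show (4⁻¹ : ENNReal) = ENNReal.ofReal (1 / 4) by
      rw [one_div, ENNReal.ofReal_inv_of_pos (by norm_num)]; norm_num,
    ← ENNReal.ofReal_mul (by norm_num)]
  refine ENNReal.ofReal_le_ofReal (mul_le_mul_of_nonneg_left (Real.exp_le_exp.2 ?_) (by norm_num))
  push_cast
  linarith
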